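/- Let $n \ge 1$ and let $\mathcal{H}_n$ be the real vector space of $n\times n$ complex Hermitian matrices. A matrix $A\in\mathcal{H}_n$ is positive definite if $x^*Ax>0$ for all nonzero $x\in\mathbb{C}^n$; let $\mathrm{PD}_n\subseteq\mathcal{H}_n$ be the set of positive definite matrices. Let $\mathcal{L}:\mathcal{H}_n\to\mathcal{H}_n$ be a real-linear operator. Then $\mathcal{L}(\mathrm{PD}_n)=\mathrm{PD}_n$ if and only if there is an invertible matrix $R\in\mathbb{C}^{n\times n}$ such that either $\mathcal{L}(A)=RAR^*$ for all $A\in\mathcal{H}_n$, or $\mathcal{L}(A)=RA^TR^*$ for all $A\in\mathcal{H}_n$. -/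

import Mathlib

open scoped ComplexOrder Matrix

/-- The real vector space of `n × n` complex Hermitian matrices. -/
abbrev HermitianMatrices (n : ℕ) : Type :=
  selfAdjoint (Matrix (Fin n) (Fin n) ℂ)

/-- The set of positive definite matrices, as a subset of the space of Hermitian matrices. -/
def positiveDefiniteMatrices (n : ℕ) : Set (HermitianMatrices n) :=
  {A | (A : Matrix (Fin n) (Fin n) ℂ).PosDef}

/-!
A map `L` with `L(PD) = PD` is bijective because the positive definite matrices span, and `L` and
`L⁻¹` preserve the closure of that cone, the positive semidefinite matrices. Hence `L` permutes its
extreme rays, which are spanned by the rank-one matrices `x x*`. After composing `L` with a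
congruence it fixes every `eᵢ eᵢ*` and the all-ones matrix. Positivity then makes it act on each
entry separately: trivially on the diagonal, and on the entry `(k, l)` by a real-linear isometry of
the scalars fixing `1`, which is the identity or the conjugation. As images of rank-one matrices
have rank one, the choice is the same for all `(k, l)`, so `L` is the identity or the transposition.
-/

open Matrix

/-- The Hermitian matrices over `𝕜 = ℝ` or `ℂ` indexed by `ι`, as a real vector space; for `𝕜 = ℝ`
these are the symmetric matrices. -/
abbrev SelfAdjointMatrix (ι 𝕜 : Type*) [RCLike 𝕜] : Type _ :=
  selfAdjoint (Matrix ι ι 𝕜)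

namespace SelfAdjointMatrix

variable {ι 𝕜 : Type*} [RCLike 𝕜]

theorem star_apply (A : SelfAdjointMatrix ι 𝕜) (i j : ι) : star (A.1 i j) = A.1 j i :=
  congrFun (congrFun A.2 j) i

/-- The positive semidefinite Hermitian matrix `x x*`. -/
def rankOne (x : ι → 𝕜) : SelfAdjointMatrix ι 𝕜 :=
  ⟨vecMulVec x (star x), by
    rw [selfAdjoint.mem_iff, star_eq_conjTranspose, conjTranspose_vecMulVec, star_star]⟩

theorem coe_rankOne (x : ι → 𝕜) : (rankOne x).1 = vecMulVec x (star x) := rfl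

theorem rankOne_apply (x : ι → 𝕜) (i j : ι) : (rankOne x).1 i j = x i * star (x j) := rfl

theorem rankOne_apply_self (x : ι → 𝕜) (i : ι) : (rankOne x).1 i i = (‖x i‖ : 𝕜) ^ 2 :=
  RCLike.mul_conj (x i)

theorem rankOne_eq_zero_iff {x : ι → 𝕜} : rankOne x = 0 ↔ x = 0 := by
  rw [Subtype.ext_iff, coe_rankOne, AddSubgroup.coe_zero, vecMulVec_eq_zero, star_eq_zero, or_self]

theorem rankOne_smul (c : 𝕜) (x : ι → 𝕜) : rankOne (c • x) = ‖c‖ ^ 2 • rankOne x := by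
  ext i j
  rw [selfAdjoint.val_smul, Matrix.smul_apply, rankOne_apply, rankOne_apply,
    RCLike.real_smul_eq_coe_mul, RCLike.ofReal_pow, ← RCLike.mul_conj, Pi.smul_apply,
    Pi.smul_apply, star_smul]
  simp only [smul_eq_mul, RCLike.star_def]
  ring

/-- The real-linear functional reading off an entry. -/
noncomputable def entryₗ (i j : ι) : SelfAdjointMatrix ι 𝕜 →ₗ[ℝ] 𝕜 :=
  entryLinearMap ℝ 𝕜 i j ∘ₗ (selfAdjoint.submodule ℝ (Matrix ι ι 𝕜)).subtype

theorem entryₗ_apply (i j : ι) (A : SelfAdjointMatrix ι 𝕜) : entryₗ i j A = A.1 i j := rfl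

/-- Transposition, which on Hermitian matrices is entrywise conjugation. -/
def transposeₗ : Module.End ℝ (SelfAdjointMatrix ι 𝕜) where
  toFun A := ⟨A.1ᵀ, IsHermitian.transpose A.2⟩
  map_add' _ _ := rfl
  map_smul' _ _ := rfl

theorem transposeₗ_surjective :
    Function.Surjective (transposeₗ : Module.End ℝ (SelfAdjointMatrix ι 𝕜)) :=
  fun A => ⟨transposeₗ A, rfl⟩

section HermitianUnits

variable [DecidableEq ι]

/-- The Hermitian matrix units `z ↦ z Eᵢⱼ + z̄ Eⱼᵢ`. For `i = j` this is `2 re z Eᵢᵢ`. -/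
noncomputable def hermitianSingle (i j : ι) : 𝕜 →ₗ[ℝ] SelfAdjointMatrix ι 𝕜 :=
  (2 : ℝ) • selfAdjointPart ℝ ∘ₗ singleLinearMap ℝ i j

theorem coe_hermitianSingle (i j : ι) (z : 𝕜) :
    (hermitianSingle i j z).1 = single i j z + single j i (star z) := by
  change (2 : ℝ) • (⅟2 : ℝ) • (single i j z + star (single i j z)) = _
  rw [smul_smul, mul_invOf_self, one_smul, star_eq_conjTranspose, conjTranspose_single]

theorem hermitianSingle_star (i j : ι) (z : 𝕜) :
    hermitianSingle i j (star z) = hermitianSingle j i z := by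
  apply Subtype.ext
  rw [coe_hermitianSingle, coe_hermitianSingle, star_star, add_comm]

theorem vecMulVec_single_single (i j : ι) (z w : 𝕜) :
    vecMulVec (Pi.single i z) (Pi.single j w) = single i j (z * w) := by
  ext k l
  rw [vecMulVec_apply, single_apply, Pi.single_apply, Pi.single_apply]
  grind

theorem coe_rankOne_single (i : ι) : (rankOne (Pi.single i (1 : 𝕜))).1 = single i i 1 := by
  rw [coe_rankOne, Pi.star_single, vecMulVec_single_single, star_one, mul_one]

theorem sum_rankOne_single [Fintype ι] : ∑ i : ι, rankOne (Pi.single i (1 : 𝕜)) = 1 := by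
  apply Subtype.ext
  rw [AddSubgroup.val_finsetSum]
  simp only [coe_rankOne_single]
  exact sum_single_one

theorem hermitianSingle_self (i : ι) (z : 𝕜) :
    hermitianSingle i i z = (2 * RCLike.re z) • rankOne (Pi.single i 1) := by
  apply Subtype.ext
  rw [coe_hermitianSingle, selfAdjoint.val_smul, coe_rankOne_single, smul_single, ← single_add,
    RCLike.star_def, RCLike.add_conj, RCLike.real_smul_eq_coe_mul, mul_one, RCLike.ofReal_mul,
    RCLike.ofReal_ofNat]

theorem rankOne_single_add_single (i j : ι) (z w : 𝕜) :
    rankOne (Pi.single i z + Pi.single j w) =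
      ‖z‖ ^ 2 • rankOne (Pi.single i 1) + ‖w‖ ^ 2 • rankOne (Pi.single j 1) +
        hermitianSingle i j (z * star w) := by
  have single_eq (k : ι) (c : 𝕜) : c • (Pi.single k 1 : ι → 𝕜) = Pi.single k c := by
    rw [← Pi.single_smul, smul_eq_mul, mul_one]
  rw [← rankOne_smul, ← rankOne_smul, single_eq, single_eq]
  apply Subtype.ext
  simp only [AddSubgroup.coe_add, coe_rankOne, coe_hermitianSingle, star_add, Pi.star_single,
    add_vecMulVec, vecMulVec_add, vecMulVec_single_single, star_mul, star_star]
  abel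

theorem two_smul_eq_sum_hermitianSingle [Fintype ι] (A : SelfAdjointMatrix ι 𝕜) :
    (2 : ℝ) • A = ∑ i, ∑ j, hermitianSingle i j (A.1 i j) :=
  calc (2 : ℝ) • A = (2 : ℝ) • selfAdjointPart ℝ A.1 := by rw [A.2.selfAdjointPart_apply ℝ]
    _ = ((2 : ℝ) • selfAdjointPart ℝ) (∑ i, ∑ j, single i j (A.1 i j)) := by
      rw [← matrix_eq_sum_single, LinearMap.smul_apply]
    _ = ∑ i, ∑ j, hermitianSingle i j (A.1 i j) := by simp only [map_sum]; rfl

end HermitianUnits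

section Congruence

variable [Fintype ι] [DecidableEq ι]

/-- The congruence `A ↦ R A R*`, multiplicative in `R`. -/
def congruence : Matrix ι ι 𝕜 →* Module.End ℝ (SelfAdjointMatrix ι 𝕜) where
  toFun R :=
    { toFun A := ⟨R * A.1 * Rᴴ, A.2.conjugate R⟩
      map_add' A B := Subtype.ext <| by simp only [AddSubgroup.coe_add, mul_add, add_mul]
      map_smul' r A := Subtype.ext <| by simp }
  map_one' := LinearMap.ext fun A => Subtype.ext <| by simp
  map_mul' R S := LinearMap.ext fun A => Subtype.ext <| by simp [mul_assoc]

theorem coe_congruence (R : Matrix ι ι 𝕜) (A : SelfAdjointMatrix ι 𝕜) :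
    (congruence R A).1 = R * A.1 * Rᴴ := rfl

theorem congruence_rankOne (R : Matrix ι ι 𝕜) (x : ι → 𝕜) :
    congruence R (rankOne x) = rankOne (R *ᵥ x) :=
  Subtype.ext <| by rw [coe_congruence, coe_rankOne, coe_rankOne, mul_vecMulVec, vecMulVec_mul,
    star_mulVec]

theorem congruence_bijective {R : Matrix ι ι 𝕜} (hR : IsUnit R) :
    Function.Bijective (congruence R) :=
  (Module.End.isUnit_iff _).mp (hR.map congruence)

end Congruence

section PositiveCone

variable (ι 𝕜) in
/-- The positive definite matrices, as a subset of the space of Hermitian matrices. -/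
def posDefSet : Set (SelfAdjointMatrix ι 𝕜) :=
  {A | A.1.PosDef}

variable (ι 𝕜) in
/-- The positive semidefinite matrices, as a subset of the space of Hermitian matrices. -/
def posSemidefSet : Set (SelfAdjointMatrix ι 𝕜) :=
  {A | A.1.PosSemidef}

/-- `A` spans an extreme ray of the cone of positive semidefinite matrices. The zero matrix is
included, and the scalar `t` is not required to be nonnegative. -/
def IsExtremal (A : SelfAdjointMatrix ι 𝕜) : Prop :=
  A ∈ posSemidefSet ι 𝕜 ∧
    ∀ B ∈ posSemidefSet ι 𝕜, A - B ∈ posSemidefSet ι 𝕜 → ∃ t : ℝ, B = t • A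

theorem IsExtremal.map {e : SelfAdjointMatrix ι 𝕜 ≃ₗ[ℝ] SelfAdjointMatrix ι 𝕜}
    (he : Set.MapsTo e (posSemidefSet ι 𝕜) (posSemidefSet ι 𝕜))
    (he' : Set.MapsTo e.symm (posSemidefSet ι 𝕜) (posSemidefSet ι 𝕜))
    {A : SelfAdjointMatrix ι 𝕜} (hA : IsExtremal A) : IsExtremal (e A) := by
  refine ⟨he hA.1, fun B hB hAB => ?_⟩
  have hAB' : A - e.symm B ∈ posSemidefSet ι 𝕜 := by
    simpa only [map_sub, LinearEquiv.symm_apply_apply] using he' hAB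
  obtain ⟨t, ht⟩ := hA.2 _ (he' hB) hAB'
  exact ⟨t, by rw [← map_smul, ← ht, LinearEquiv.apply_symm_apply]⟩

theorem star_dotProduct_rankOne_mulVec [Fintype ι] (x u : ι → 𝕜) :
    star u ⬝ᵥ (rankOne x).1 *ᵥ u = (‖star x ⬝ᵥ u‖ : 𝕜) ^ 2 := by
  rw [coe_rankOne, vecMulVec_mulVec, dotProduct_smul, MulOpposite.smul_eq_mul_unop,
    MulOpposite.unop_op, star_dotProduct, ← RCLike.conj_mul, RCLike.star_def]

theorem one_mem_posDefSet [Fintype ι] [DecidableEq ι] : 1 ∈ posDefSet ι 𝕜 :=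
  PosDef.one

variable [Finite ι]

theorem rankOne_mem_posSemidefSet (x : ι → 𝕜) : rankOne x ∈ posSemidefSet ι 𝕜 :=
  posSemidef_vecMulVec_self_star x

theorem exists_eq_sum_rankOne {A : SelfAdjointMatrix ι 𝕜} (hA : A ∈ posSemidefSet ι 𝕜) :
    ∃ (m : ℕ) (v : Fin m → ι → 𝕜), A = ∑ i, rankOne (v i) := by
  obtain ⟨m, v, hv⟩ := posSemidef_iff_eq_sum_vecMulVec.mp hA
  exact ⟨m, v, Subtype.ext <| by rw [hv, AddSubgroup.val_finsetSum]; rfl⟩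

theorem sum_rankOne_sub_rankOne_mem_posSemidefSet {κ : Type*} [Fintype κ]
    (v : κ → ι → 𝕜) (i : κ) : ∑ j, rankOne (v j) - rankOne (v i) ∈ posSemidefSet ι 𝕜 := by
  classical
  rw [← Finset.add_sum_erase _ _ (Finset.mem_univ i), add_sub_cancel_left]
  change Matrix.PosSemidef (Subtype.val _)
  rw [AddSubgroup.val_finsetSum]
  exact posSemidef_sum _ fun j _ => rankOne_mem_posSemidefSet (v j)

theorem exists_eq_smul_of_rankOne_sub_rankOne_mem_posSemidefSet {x v : ι → 𝕜}
    (h : rankOne x - rankOne v ∈ posSemidefSet ι 𝕜) : ∃ c : 𝕜, v = c • x := by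
  cases nonempty_fintype ι
  have orthogonal (u : ι → 𝕜) (hu : star x ⬝ᵥ u = 0) : star v ⬝ᵥ u = 0 := by
    have hsub : (0 : 𝕜) ≤ (‖star x ⬝ᵥ u‖ : 𝕜) ^ 2 - (‖star v ⬝ᵥ u‖ : 𝕜) ^ 2 := by
      rw [← star_dotProduct_rankOne_mulVec, ← star_dotProduct_rankOne_mulVec, ← dotProduct_sub,
        ← sub_mulVec]
      exact h.dotProduct_mulVec_nonneg u
    have hle : ‖star v ⬝ᵥ u‖ ^ 2 ≤ 0 := by
      simpa only [hu, norm_zero, RCLike.ofReal_zero, ne_eq, OfNat.ofNat_ne_zero, not_false_eq_true,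
        zero_pow, zero_sub, neg_nonneg, ← RCLike.ofReal_pow, RCLike.ofReal_nonpos] using hsub
    exact norm_eq_zero.mp (pow_eq_zero_iff two_ne_zero |>.mp (le_antisymm hle (sq_nonneg _)))
  set c := (star x ⬝ᵥ v) / (star x ⬝ᵥ x)
  set u := v - c • x
  have hxu : star x ⬝ᵥ u = 0 := by
    rcases eq_or_ne x 0 with rfl | hx
    · simp
    · rw [dotProduct_sub, dotProduct_smul, smul_eq_mul,
        div_mul_cancel₀ _ (dotProduct_star_self_eq_zero.not.mpr hx), sub_self]
  have huu : star u ⬝ᵥ u = 0 := by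
    rw [star_sub, star_smul, sub_dotProduct, smul_dotProduct, orthogonal u hxu, hxu, smul_zero,
      sub_zero]
  exact ⟨c, sub_eq_zero.mp (dotProduct_star_self_eq_zero.mp huu)⟩

theorem isExtremal_rankOne (x : ι → 𝕜) : IsExtremal (rankOne x) := by
  refine ⟨rankOne_mem_posSemidefSet x, fun B hB hxB => ?_⟩
  obtain ⟨m, v, rfl⟩ := exists_eq_sum_rankOne hB
  have parallel (i : Fin m) : ∃ c : 𝕜, v i = c • x := by
    refine exists_eq_smul_of_rankOne_sub_rankOne_mem_posSemidefSet ?_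
    rw [← sub_add_sub_cancel]
    exact PosSemidef.add hxB (sum_rankOne_sub_rankOne_mem_posSemidefSet v i)
  choose c hc using parallel
  refine ⟨∑ i, ‖c i‖ ^ 2, ?_⟩
  rw [Finset.sum_smul]
  exact Finset.sum_congr rfl fun i _ => by rw [hc, rankOne_smul]

theorem pos_of_rankOne_eq_smul {A : SelfAdjointMatrix ι 𝕜} (hA : A ∈ posSemidefSet ι 𝕜)
    {x : ι → 𝕜} (hx : x ≠ 0) {t : ℝ} (h : rankOne x = t • A) : 0 < t := by
  cases nonempty_fintype ι
  have trace_rankOne : (rankOne x).1.trace = x ⬝ᵥ star x := trace_vecMulVec _ _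
  have trace_eq : RCLike.re (x ⬝ᵥ star x) = t * RCLike.re A.1.trace := by
    rw [← trace_rankOne, h, selfAdjoint.val_smul, trace_smul, RCLike.smul_re]
  have trace_pos : 0 < RCLike.re (x ⬝ᵥ star x) :=
    (RCLike.pos_iff.mp (dotProduct_self_star_pos_iff.mpr hx)).1
  rw [trace_eq] at trace_pos
  exact pos_of_mul_pos_left trace_pos (RCLike.nonneg_iff.mp hA.trace_nonneg).1

theorem IsExtremal.exists_eq_rankOne {A : SelfAdjointMatrix ι 𝕜} (hA : IsExtremal A) :
    ∃ x, A = rankOne x := by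
  obtain ⟨m, v, hv⟩ := exists_eq_sum_rankOne hA.1
  by_cases hv0 : ∀ i, v i = 0
  · refine ⟨0, ?_⟩
    rw [hv, rankOne_eq_zero_iff.mpr rfl]
    exact Finset.sum_eq_zero fun i _ => rankOne_eq_zero_iff.mpr (hv0 i)
  push Not at hv0
  obtain ⟨i, hi⟩ := hv0
  obtain ⟨t, ht⟩ := hA.2 _ (rankOne_mem_posSemidefSet (v i))
    (hv ▸ sum_rankOne_sub_rankOne_mem_posSemidefSet v i)
  have ht0 : 0 < t := pos_of_rankOne_eq_smul hA.1 hi ht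
  refine ⟨((√t⁻¹ : ℝ) : 𝕜) • v i, ?_⟩
  rw [rankOne_smul, RCLike.norm_ofReal, sq_abs, Real.sq_sqrt (inv_nonneg.mpr ht0.le), ht,
    inv_smul_smul₀ ht0.ne']

theorem mem_posSemidefSet_of_forall_add_smul {A B : SelfAdjointMatrix ι 𝕜}
    (h : ∀ ε : ℝ, 0 < ε → A + ε • B ∈ posSemidefSet ι 𝕜) : A ∈ posSemidefSet ι 𝕜 := by
  cases nonempty_fintype ι
  refine .of_dotProduct_mulVec_nonneg A.2 fun x => ?_
  have lim : Filter.Tendsto (fun ε : ℝ => star x ⬝ᵥ A.1 *ᵥ x + ε • (star x ⬝ᵥ B.1 *ᵥ x))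
      (nhdsWithin 0 (Set.Ioi 0)) (nhds (star x ⬝ᵥ A.1 *ᵥ x)) := by
    refine Filter.Tendsto.mono_left ?_ nhdsWithin_le_nhds
    exact Continuous.tendsto' (by fun_prop) _ _ (by rw [zero_smul, add_zero])
  refine ge_of_tendsto lim (Filter.eventually_mem_set.mpr ?_)
  filter_upwards [self_mem_nhdsWithin] with ε hε
  have := (h ε hε).dotProduct_mulVec_nonneg x
  rwa [AddSubgroup.coe_add, selfAdjoint.val_smul, add_mulVec, smul_mulVec, dotProduct_add,
    dotProduct_smul] at this

theorem span_posDefSet : Submodule.span ℝ (posDefSet ι 𝕜) = ⊤ := by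
  classical
  cases nonempty_fintype ι
  have sq_add_one_mem (B : SelfAdjointMatrix ι 𝕜) : B ^ 2 + 1 ∈ posDefSet ι 𝕜 := by
    have hsq : (B.1 ^ 2).PosSemidef := by
      have h := posSemidef_self_mul_conjTranspose B.1
      rwa [show B.1ᴴ = B.1 from B.2, ← sq] at h
    exact PosDef.posSemidef_add hsq PosDef.one
  refine eq_top_iff.mpr fun A _ => ?_
  have hA : (2 : ℝ) • A = ((A + 1) ^ 2 + 1) - (A ^ 2 + 1) - 1 := by
    apply Subtype.ext
    simp only [AddSubgroup.coe_sub, AddSubgroup.coe_add, selfAdjoint.val_pow,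
      selfAdjoint.val_one, two_smul]
    noncomm_ring
  rw [← Submodule.smul_mem_iff _ (two_ne_zero' ℝ), hA]
  exact sub_mem (sub_mem (Submodule.subset_span (sq_add_one_mem _))
    (Submodule.subset_span (sq_add_one_mem _))) (Submodule.subset_span one_mem_posDefSet)

end PositiveCone

section PosDefPreservers

theorem image_posDefSet_of_surjective {L : Module.End ℝ (SelfAdjointMatrix ι 𝕜)}
    (hL : Function.Surjective L) (h : ∀ A, L A ∈ posDefSet ι 𝕜 ↔ A ∈ posDefSet ι 𝕜) :
    L '' posDefSet ι 𝕜 = posDefSet ι 𝕜 := by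
  conv_lhs => rw [← show L ⁻¹' posDefSet ι 𝕜 = posDefSet ι 𝕜 from Set.ext h]
  exact Set.image_preimage_eq _ hL

theorem image_transposeₗ_posDefSet :
    transposeₗ '' posDefSet ι 𝕜 = posDefSet ι 𝕜 :=
  image_posDefSet_of_surjective transposeₗ_surjective fun _ => PosDef.transpose_iff

theorem image_congruence_posDefSet [Fintype ι] [DecidableEq ι] {R : Matrix ι ι 𝕜} (hR : IsUnit R) :
    congruence R '' posDefSet ι 𝕜 = posDefSet ι 𝕜 :=
  image_posDefSet_of_surjective (congruence_bijective hR).surjective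
    fun _ => hR.posDef_star_right_conjugate_iff

/-- `L` maps every rank-one matrix `x x*` to a matrix of the same shape. The value may be zero. -/
def PreservesRankOne (L : Module.End ℝ (SelfAdjointMatrix ι 𝕜)) : Prop :=
  ∀ x, ∃ y, L (rankOne x) = rankOne y

variable [Finite ι]

instance : Module.Finite ℝ (SelfAdjointMatrix ι 𝕜) :=
  inferInstanceAs (Module.Finite ℝ (selfAdjoint.submodule ℝ (Matrix ι ι 𝕜)))

theorem bijective_of_image_posDefSet {L : Module.End ℝ (SelfAdjointMatrix ι 𝕜)}
    (h : L '' posDefSet ι 𝕜 = posDefSet ι 𝕜) : Function.Bijective L := by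
  have hsurj : Function.Surjective L := by
    rw [← LinearMap.range_eq_top, eq_top_iff, ← span_posDefSet, Submodule.span_le, ← h]
    exact Set.image_subset_range _ _
  exact ⟨LinearMap.injective_iff_surjective.mpr hsurj, hsurj⟩

theorem mapsTo_posSemidefSet_of_mapsTo_posDefSet {L : Module.End ℝ (SelfAdjointMatrix ι 𝕜)}
    (h : Set.MapsTo L (posDefSet ι 𝕜) (posDefSet ι 𝕜)) :
    Set.MapsTo L (posSemidefSet ι 𝕜) (posSemidefSet ι 𝕜) := by
  classical
  cases nonempty_fintype ι
  refine fun A hA => mem_posSemidefSet_of_forall_add_smul (B := L 1) fun ε hε => ?_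
  rw [← map_smul, ← map_add]
  exact (h (PosDef.posSemidef_add hA (one_mem_posDefSet.smul hε))).posSemidef

theorem preservesRankOne_of_image_posDefSet {L : Module.End ℝ (SelfAdjointMatrix ι 𝕜)}
    (h : L '' posDefSet ι 𝕜 = posDefSet ι 𝕜) : PreservesRankOne L := by
  set e := LinearEquiv.ofBijective L (bijective_of_image_posDefSet h)
  have he : Set.MapsTo e (posDefSet ι 𝕜) (posDefSet ι 𝕜) := Set.mapsTo_iff_image_subset.mpr h.le
  have he' : Set.MapsTo e.symm (posDefSet ι 𝕜) (posDefSet ι 𝕜) := by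
    intro B hB
    obtain ⟨A, hA, rfl⟩ := h.ge hB
    rwa [show L A = e A from rfl, e.symm_apply_apply]
  exact fun x => ((isExtremal_rankOne x).map (mapsTo_posSemidefSet_of_mapsTo_posDefSet he)
    (mapsTo_posSemidefSet_of_mapsTo_posDefSet he')).exists_eq_rankOne

end PosDefPreservers

section Scalars

theorem eq_zero_of_forall_nonneg_add_smul {a b : 𝕜} (h : ∀ r : ℝ, 0 ≤ a + r • b) : b = 0 := by
  have key (r : ℝ) : 0 ≤ RCLike.re a + r * RCLike.re b ∧ RCLike.im a + r * RCLike.im b = 0 := by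
    have hr := RCLike.nonneg_iff.mp (h r)
    rwa [map_add, map_add, RCLike.smul_re, RCLike.smul_im] at hr
  refine RCLike.ext ?_ ?_
  · rw [map_zero]
    by_contra hb
    have := (key (-(RCLike.re a + 1) / RCLike.re b)).1
    rw [div_mul_cancel₀ _ hb] at this
    linarith
  · rw [map_zero]
    linarith [(key 0).2, (key 1).2]

theorem re_map_of_norm_map {f : 𝕜 →ₗ[ℝ] 𝕜} (hf : ∀ z, ‖f z‖ = ‖z‖) (h1 : f 1 = 1) (z : 𝕜) :
    RCLike.re (f z) = RCLike.re z := by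
  have h : RCLike.normSq (f z + 1) = RCLike.normSq (z + 1) := by
    rw [RCLike.normSq_eq_def', RCLike.normSq_eq_def', ← hf (z + 1), map_add, h1]
  rw [RCLike.normSq_add, RCLike.normSq_add, RCLike.normSq_eq_def' (f z), hf,
    ← RCLike.normSq_eq_def', map_one, map_one, mul_one, mul_one] at h
  linarith

theorem map_I_of_norm_map {f : 𝕜 →ₗ[ℝ] 𝕜} (hf : ∀ z, ‖f z‖ = ‖z‖) (h1 : f 1 = 1) :
    f RCLike.I = RCLike.I ∨ f RCLike.I = -RCLike.I := by
  have hfI : f RCLike.I = RCLike.im (f RCLike.I) * RCLike.I := by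
    conv_lhs => rw [← RCLike.re_add_im (f RCLike.I), re_map_of_norm_map hf h1, RCLike.I_re,
      RCLike.ofReal_zero, zero_add]
  rcases eq_or_ne (RCLike.I : 𝕜) 0 with hI | hI
  · left
    rw [hI, map_zero]
  · have habs : |RCLike.im (f RCLike.I)| = 1 := by
      have := hf RCLike.I
      rwa [hfI, norm_mul, RCLike.norm_ofReal, mul_eq_right₀ (norm_ne_zero_iff.mpr hI)] at this
    rw [hfI]
    rcases eq_or_eq_neg_of_abs_eq habs with h | h <;> simp [h]

theorem eq_self_or_eq_star_of_norm_map {f : 𝕜 →ₗ[ℝ] 𝕜} (hf : ∀ z, ‖f z‖ = ‖z‖) (h1 : f 1 = 1) :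
    (∀ z, f z = z) ∨ (∀ z, f z = star z) := by
  have hz (z : 𝕜) : f z = RCLike.re z + RCLike.im z * f RCLike.I := by
    have key : z = RCLike.re z • (1 : 𝕜) + RCLike.im z • RCLike.I := by
      rw [RCLike.real_smul_eq_coe_mul, RCLike.real_smul_eq_coe_mul, mul_one, RCLike.re_add_im]
    conv_lhs => rw [key, map_add, map_smul, map_smul, h1]
    rw [RCLike.real_smul_eq_coe_mul, RCLike.real_smul_eq_coe_mul, mul_one]
  refine (map_I_of_norm_map hf h1).imp (fun h z => ?_) (fun h z => ?_)
  · rw [hz, h, RCLike.re_add_im]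
  · rw [hz, h, RCLike.star_def, RCLike.conj_eq_re_sub_im, mul_neg, sub_eq_add_neg]

end Scalars

section NormalForm

variable [DecidableEq ι]

/-- A preserver of rank-one matrices that fixes the diagonal matrix units: the shape to which a
preserver of the positive definite matrices is brought by composing it with a congruence. -/
structure IsNormalized (F : Module.End ℝ (SelfAdjointMatrix ι 𝕜)) : Prop where
  preservesRankOne : PreservesRankOne F
  map_rankOne_single (i : ι) : F (rankOne (Pi.single i 1)) = rankOne (Pi.single i 1)

namespace IsNormalized

variable {F : Module.End ℝ (SelfAdjointMatrix ι 𝕜)}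

theorem map_rankOne_single_add_single (hF : IsNormalized F) (i j : ι) (z w : 𝕜) :
    F (rankOne (Pi.single i z + Pi.single j w)) =
      ‖z‖ ^ 2 • rankOne (Pi.single i 1) + ‖w‖ ^ 2 • rankOne (Pi.single j 1) +
        F (hermitianSingle i j (z * star w)) := by
  rw [rankOne_single_add_single, map_add, map_add, map_smul, map_smul, hF.map_rankOne_single,
    hF.map_rankOne_single]

/-- The `k`-th diagonal entry of the image of `(z eᵢ + r eⱼ)(z eᵢ + r eⱼ)*` is nonnegative and, as
`k ≠ j`, affine in `r : ℝ`, hence constant. -/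
theorem map_hermitianSingle_diag_of_ne (hF : IsNormalized F) (i : ι) {j k : ι} (hjk : j ≠ k)
    (z : 𝕜) : (F (hermitianSingle i j z)).1 k k = 0 := by
  refine eq_zero_of_forall_nonneg_add_smul
    (a := (‖z‖ ^ 2 • rankOne (Pi.single i (1 : 𝕜))).1 k k) fun r => ?_
  obtain ⟨y, hy⟩ := hF.preservesRankOne (Pi.single i z + Pi.single j (r : 𝕜))
  rw [hF.map_rankOne_single_add_single, RCLike.star_def, RCLike.conj_ofReal, mul_comm,
    ← RCLike.real_smul_eq_coe_mul, map_smul, map_smul] at hy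
  have hk := congrArg (entryₗ k k) hy
  rw [map_add, map_add] at hk
  have hjj : (rankOne (Pi.single j (1 : 𝕜))).1 k k = 0 := by
    rw [coe_rankOne_single, single_apply_of_row_ne hjk]
  rw [map_smul (entryₗ k k) (‖(r : 𝕜)‖ ^ 2), map_smul (entryₗ k k) r, entryₗ_apply, entryₗ_apply,
    entryₗ_apply, entryₗ_apply, hjj, smul_zero, add_zero, rankOne_apply_self] at hk
  rw [hk]
  exact_mod_cast sq_nonneg ‖y k‖

theorem map_hermitianSingle_diag (hF : IsNormalized F) {i j k : ι} (h : i ≠ k ∨ j ≠ k)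
    (z : 𝕜) : (F (hermitianSingle i j z)).1 k k = 0 := by
  rcases h with h | h
  · rw [← star_star z, hermitianSingle_star]
    exact hF.map_hermitianSingle_diag_of_ne j h (star z)
  · exact hF.map_hermitianSingle_diag_of_ne i h z

/-- The real-linear map of `𝕜` through which a normalized preserver acts on the entry `(k, l)`,
`k ≠ l`; see `map_apply`. -/
noncomputable def entryMap (F : Module.End ℝ (SelfAdjointMatrix ι 𝕜)) (k l : ι) : 𝕜 →ₗ[ℝ] 𝕜 :=
  entryₗ k l ∘ₗ F ∘ₗ hermitianSingle k l

theorem entryMap_swap (F : Module.End ℝ (SelfAdjointMatrix ι 𝕜)) (k l : ι) (z : 𝕜) :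
    entryMap F l k (star z) = star (entryMap F k l z) := by
  change (F (hermitianSingle l k (star z))).1 l k = star ((F (hermitianSingle k l z)).1 k l)
  rw [hermitianSingle_star, star_apply]

theorem two_smul_map_apply [Fintype ι] (F : Module.End ℝ (SelfAdjointMatrix ι 𝕜))
    (A : SelfAdjointMatrix ι 𝕜) (k l : ι) :
    (2 : ℝ) • (F A).1 k l = ∑ i, ∑ j, (F (hermitianSingle i j (A.1 i j))).1 k l := by
  rw [← entryₗ_apply, ← map_smul, ← map_smul, two_smul_eq_sum_hermitianSingle]
  simp only [map_sum, entryₗ_apply]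

variable [Finite ι]

theorem map_apply_self (hF : IsNormalized F) (A : SelfAdjointMatrix ι 𝕜) (k : ι) :
    (F A).1 k k = A.1 k k := by
  cases nonempty_fintype ι
  apply smul_right_injective 𝕜 (two_ne_zero' ℝ)
  change (2 : ℝ) • (F A).1 k k = (2 : ℝ) • A.1 k k
  have hre : (RCLike.re (A.1 k k) : 𝕜) = A.1 k k := RCLike.conj_eq_iff_re.mp (star_apply A k k)
  rw [two_smul_map_apply, Fintype.sum_eq_single k, Fintype.sum_eq_single k, hermitianSingle_self,
    map_smul, hF.map_rankOne_single, selfAdjoint.val_smul, coe_rankOne_single, Matrix.smul_apply,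
    single_apply_same, mul_smul, RCLike.real_smul_eq_coe_mul (RCLike.re _), mul_one, hre]
  · exact fun j hj => hF.map_hermitianSingle_diag (.inr hj) _
  · exact fun i hi => Finset.sum_eq_zero fun j _ => hF.map_hermitianSingle_diag (.inl hi) _

theorem norm_eq_of_map_rankOne (hF : IsNormalized F) {x y : ι → 𝕜}
    (h : F (rankOne x) = rankOne y) (k : ι) : ‖y k‖ = ‖x k‖ := by
  have hk := hF.map_apply_self (rankOne x) k
  rw [h, rankOne_apply_self, rankOne_apply_self] at hk
  exact (pow_left_inj₀ (norm_nonneg _) (norm_nonneg _) two_ne_zero).mp (by exact_mod_cast hk)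

theorem map_hermitianSingle_row (hF : IsNormalized F) {i j k : ι} (hik : i ≠ k) (hjk : j ≠ k)
    (z : 𝕜) (l : ι) : (F (hermitianSingle i j z)).1 k l = 0 := by
  obtain ⟨y, hy⟩ := hF.preservesRankOne (Pi.single i z + Pi.single j 1)
  have hyk : y k = 0 := by
    simpa [hik.symm, hjk.symm] using hF.norm_eq_of_map_rankOne hy k
  have hkl := congrArg (entryₗ k l) hy
  rw [hF.map_rankOne_single_add_single, map_add, map_add, map_smul, map_smul] at hkl
  simpa [entryₗ_apply, coe_rankOne_single, rankOne_apply, hyk, hik, hjk] using hkl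

theorem map_hermitianSingle_apply_eq_zero (hF : IsNormalized F) {i j k l : ι} (hkl : k ≠ l)
    (h₁ : (i, j) ≠ (k, l)) (h₂ : (i, j) ≠ (l, k)) (z : 𝕜) :
    (F (hermitianSingle i j z)).1 k l = 0 := by
  have : (i ≠ k ∧ j ≠ k) ∨ (i ≠ l ∧ j ≠ l) := by grind
  rcases this with ⟨hik, hjk⟩ | ⟨hil, hjl⟩
  · exact hF.map_hermitianSingle_row hik hjk z l
  · rw [← star_apply, hF.map_hermitianSingle_row hil hjl z k, star_zero]

theorem map_apply (hF : IsNormalized F) {k l : ι} (hkl : k ≠ l) (A : SelfAdjointMatrix ι 𝕜) :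
    (F A).1 k l = entryMap F k l (A.1 k l) := by
  cases nonempty_fintype ι
  apply smul_right_injective 𝕜 (two_ne_zero' ℝ)
  change (2 : ℝ) • (F A).1 k l = (2 : ℝ) • entryMap F k l (A.1 k l)
  rw [two_smul_map_apply, ← Fintype.sum_prod_type',
    Fintype.sum_eq_add (k, l) (l, k) (by simp [hkl]) fun p hp =>
      hF.map_hermitianSingle_apply_eq_zero hkl hp.1 hp.2 _, ← star_apply A k l,
    hermitianSingle_star, two_smul]
  rfl

theorem entryMap_mul_star (hF : IsNormalized F) {x y : ι → 𝕜} (h : F (rankOne x) = rankOne y)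
    {k l : ι} (hkl : k ≠ l) : entryMap F k l (x k * star (x l)) = y k * star (y l) := by
  rw [← rankOne_apply, ← rankOne_apply, ← h, hF.map_apply hkl]

theorem norm_entryMap (hF : IsNormalized F) {k l : ι} (hkl : k ≠ l) (z : 𝕜) :
    ‖entryMap F k l z‖ = ‖z‖ := by
  obtain ⟨y, hy⟩ := hF.preservesRankOne (Function.update 1 k z)
  have h := hF.entryMap_mul_star hy hkl
  have hk := hF.norm_eq_of_map_rankOne hy k
  have hl := hF.norm_eq_of_map_rankOne hy l
  simp only [Function.update_self, Function.update_of_ne hkl.symm, Pi.one_apply, star_one, mul_one,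
    norm_one] at h hk hl
  rw [h, norm_mul, norm_star, hk, hl, mul_one]

theorem entryMap_one (hF : IsNormalized F) (h1 : F (rankOne 1) = rankOne 1) {k l : ι}
    (hkl : k ≠ l) : entryMap F k l 1 = 1 := by
  simpa using hF.entryMap_mul_star h1 hkl

theorem entryMap_eq_self_or_star (hF : IsNormalized F) (h1 : F (rankOne 1) = rankOne 1) {k l : ι}
    (hkl : k ≠ l) : (∀ z, entryMap F k l z = z) ∨ (∀ z, entryMap F k l z = star z) :=
  eq_self_or_eq_star_of_norm_map (hF.norm_entryMap hkl) (hF.entryMap_one h1 hkl)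

theorem entryMap_comm (hF : IsNormalized F) (h1 : F (rankOne 1) = rankOne 1) {k l : ι}
    (hkl : k ≠ l) : entryMap F l k = entryMap F k l := by
  ext z
  rw [← star_star z, entryMap_swap]
  rcases hF.entryMap_eq_self_or_star h1 hkl with h | h <;> simp only [h]

/-- Compare the entries `(i, j)`, `(i, k)` and `(j, k)` of the image of `x x*`, where `x` has
`i`-th coordinate `z` and all other coordinates `1`. -/
theorem entryMap_congr_right (hF : IsNormalized F) (h1 : F (rankOne 1) = rankOne 1) {i j k : ι}
    (hij : i ≠ j) (hik : i ≠ k) : entryMap F i j = entryMap F i k := by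
  rcases eq_or_ne j k with rfl | hjk
  · rfl
  ext z
  obtain ⟨y, hy⟩ := hF.preservesRankOne (Function.update 1 i z)
  have hyij := hF.entryMap_mul_star hy hij
  have hyik := hF.entryMap_mul_star hy hik
  have hyjk := hF.entryMap_mul_star hy hjk
  have hyk := hF.norm_eq_of_map_rankOne hy k
  simp only [Function.update_self, Function.update_of_ne hij.symm, Function.update_of_ne hik.symm,
    Pi.one_apply, star_one, mul_one, norm_one, hF.entryMap_one h1 hjk] at hyij hyik hyjk hyk
  have hykk : y k * star (y k) = 1 := by rw [RCLike.star_def, RCLike.mul_conj, hyk]; simp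
  have hyjk' : y j = y k := by linear_combination -y j * hykk - y k * hyjk
  rw [hyij, hyik, hyjk']

theorem entryMap_congr (hF : IsNormalized F) (h1 : F (rankOne 1) = rankOne 1) {i j k l : ι}
    (hij : i ≠ j) (hkl : k ≠ l) : entryMap F i j = entryMap F k l := by
  rcases eq_or_ne i k with rfl | hik
  · exact hF.entryMap_congr_right h1 hij hkl
  · rw [hF.entryMap_congr_right h1 hij hik, ← hF.entryMap_comm h1 hik,
      hF.entryMap_congr_right h1 hik.symm hkl]

theorem eq_one_or_eq_transposeₗ (hF : IsNormalized F) (h1 : F (rankOne 1) = rankOne 1) :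
    F = 1 ∨ F = transposeₗ := by
  have ext_offDiag {G : Module.End ℝ (SelfAdjointMatrix ι 𝕜)} (hdiag : ∀ A k, (G A).1 k k = A.1 k k)
      (hoff : ∀ A k l, k ≠ l → (G A).1 k l = entryMap F k l (A.1 k l)) : F = G := by
    ext A k l
    rcases eq_or_ne k l with rfl | hkl
    · rw [hF.map_apply_self, hdiag]
    · rw [hF.map_apply hkl, hoff A k l hkl]
  by_cases h : ∀ k l, k ≠ l → ∀ z, entryMap F k l z = z
  · exact .inl (ext_offDiag (fun _ _ => rfl) fun A k l hkl => (h k l hkl _).symm)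
  · push Not at h
    obtain ⟨i, j, hij, w, hw⟩ := h
    have hstar := (hF.entryMap_eq_self_or_star h1 hij).resolve_left fun h => hw (h w)
    refine .inr (ext_offDiag (fun _ _ => rfl) fun A k l hkl => ?_)
    rw [hF.entryMap_congr h1 hkl hij, hstar, star_apply]
    rfl

end IsNormalized

end NormalForm

section Classification

variable [Fintype ι] [DecidableEq ι] {L : Module.End ℝ (SelfAdjointMatrix ι 𝕜)}

theorem PreservesRankOne.congruence_mul (hL : PreservesRankOne L) (R : Matrix ι ι 𝕜) :
    PreservesRankOne (congruence R * L) := fun x => by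
  obtain ⟨y, hy⟩ := hL x
  exact ⟨R *ᵥ y, by rw [Module.End.mul_apply, hy, congruence_rankOne]⟩

theorem PreservesRankOne.exists_isNormalized_of_map_rankOne_single (hL : PreservesRankOne L)
    {R : Matrix ι ι 𝕜} (hR : IsUnit R)
    (h : ∀ i, L (rankOne (Pi.single i 1)) = congruence R (rankOne (Pi.single i 1))) :
    ∃ G, IsNormalized G ∧ L = congruence R * G := by
  obtain ⟨R, rfl⟩ := hR
  have hfactor : L = congruence R.1 * (congruence R⁻¹.1 * L) := by
    rw [← mul_assoc, ← map_mul, R.mul_inv, map_one, one_mul]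
  refine ⟨congruence R⁻¹.1 * L, ⟨hL.congruence_mul _, fun i => ?_⟩, hfactor⟩
  apply (congruence_bijective R.isUnit).injective
  rw [← h, ← Module.End.mul_apply, ← hfactor]

theorem PreservesRankOne.exists_isNormalized (hL : PreservesRankOne L) (h1 : IsUnit (L 1).1) :
    ∃ S : Matrix ι ι 𝕜, IsUnit S ∧ ∃ G, IsNormalized G ∧ L = congruence S * G := by
  choose y hy using fun i => hL (Pi.single i 1)
  set S : Matrix ι ι 𝕜 := (of y)ᵀ
  have congr_single (i : ι) : congruence S (rankOne (Pi.single i 1)) = rankOne (y i) := by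
    rw [congruence_rankOne, mulVec_single_one]
    rfl
  have congr_one : congruence S 1 = L 1 := by
    simp only [← sum_rankOne_single, map_sum, congr_single, hy]
  have hS : IsUnit S := by
    refine isUnit_of_mul_isUnit_left (y := Sᴴ) ?_
    rwa [← congr_one, coe_congruence, selfAdjoint.val_one, mul_one] at h1
  exact ⟨S, hS, hL.exists_isNormalized_of_map_rankOne_single hS fun i => by rw [hy, congr_single]⟩

theorem IsNormalized.exists_map_rankOne_one (hL : IsNormalized L) :
    ∃ D : Matrix ι ι 𝕜, IsUnit D ∧
      ∃ G, IsNormalized G ∧ G (rankOne 1) = rankOne 1 ∧ L = congruence D * G := by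
  obtain ⟨u, hu⟩ := hL.preservesRankOne 1
  have norm_u (i : ι) : ‖u i‖ = 1 := by
    rw [hL.norm_eq_of_map_rankOne hu, Pi.one_apply, norm_one]
  have hD : IsUnit (diagonal u) := by
    rw [isUnit_diagonal, Pi.isUnit_iff]
    exact fun i => (norm_ne_zero_iff.mp (norm_u i ▸ one_ne_zero)).isUnit
  have congr_single (i : ι) :
      congruence (diagonal u) (rankOne (Pi.single i 1)) = rankOne (Pi.single i 1) := by
    rw [congruence_rankOne, diagonal_mulVec_single, ← smul_eq_mul, Pi.single_smul, rankOne_smul,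
      norm_u, one_pow, one_smul]
  have congr_one : congruence (diagonal u) (rankOne 1) = rankOne u := by
    rw [congruence_rankOne]
    congr 1
    ext i
    rw [mulVec_diagonal, Pi.one_apply, mul_one]
  obtain ⟨G, hG, rfl⟩ := hL.preservesRankOne.exists_isNormalized_of_map_rankOne_single hD
    fun i => by rw [hL.map_rankOne_single, congr_single]
  refine ⟨diagonal u, hD, G, hG, (congruence_bijective hD).injective ?_, rfl⟩
  rw [congr_one, ← hu, Module.End.mul_apply]

theorem PreservesRankOne.exists_eq_congruence (hL : PreservesRankOne L) (h1 : IsUnit (L 1).1) :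
    ∃ R : Matrix ι ι 𝕜, IsUnit R ∧ (L = congruence R ∨ L = congruence R * transposeₗ) := by
  obtain ⟨S, hS, G, hG, rfl⟩ := hL.exists_isNormalized h1
  obtain ⟨D, hD, H, hH, hH1, rfl⟩ := hG.exists_map_rankOne_one
  refine ⟨S * D, hS.mul hD, ?_⟩
  rw [← mul_assoc, map_mul]
  exact (hH.eq_one_or_eq_transposeₗ hH1).imp (fun h => by rw [h, mul_one]) (fun h => by rw [h])

end Classification

end SelfAdjointMatrix

open SelfAdjointMatrix in
theorem mainTheorem1_general {ι 𝕜 : Type*} [RCLike 𝕜] [Fintype ι] [DecidableEq ι]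
    (L : SelfAdjointMatrix ι 𝕜 →ₗ[ℝ] SelfAdjointMatrix ι 𝕜) :
    L '' posDefSet ι 𝕜 = posDefSet ι 𝕜 ↔
      ∃ R : Matrix ι ι 𝕜, IsUnit R ∧
        ((∀ A : SelfAdjointMatrix ι 𝕜,
            (L A : Matrix ι ι 𝕜) = R * (A : Matrix ι ι 𝕜) * Rᴴ) ∨
         (∀ A : SelfAdjointMatrix ι 𝕜,
            (L A : Matrix ι ι 𝕜) = R * (A : Matrix ι ι 𝕜)ᵀ * Rᴴ)) := by
  constructor
  · intro h
    have h1 : L 1 ∈ posDefSet ι 𝕜 := h ▸ Set.mem_image_of_mem L one_mem_posDefSet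
    obtain ⟨R, hR, hL⟩ := (preservesRankOne_of_image_posDefSet h).exists_eq_congruence h1.isUnit
    exact ⟨R, hR, hL.imp (fun h A => by rw [h, coe_congruence]) (fun h A => by rw [h]; rfl)⟩
  · rintro ⟨R, hR, hL | hL⟩
    · rw [show L = congruence R from LinearMap.ext fun A => Subtype.ext (hL A)]
      exact image_congruence_posDefSet hR
    · rw [show L = congruence R * transposeₗ from LinearMap.ext fun A => Subtype.ext (hL A),
        Module.End.mul_eq_comp, LinearMap.coe_comp, Set.image_comp, image_transposeₗ_posDefSet]
      exact image_congruence_posDefSet hR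

theorem mainTheorem1 (n : ℕ) (L : HermitianMatrices n →ₗ[ℝ] HermitianMatrices n) :
    L '' positiveDefiniteMatrices n = positiveDefiniteMatrices n ↔
      ∃ R : Matrix (Fin n) (Fin n) ℂ, IsUnit R ∧
        ((∀ A : HermitianMatrices n,
            (L A : Matrix (Fin n) (Fin n) ℂ) = R * (A : Matrix (Fin n) (Fin n) ℂ) * Rᴴ) ∨
         (∀ A : HermitianMatrices n,
            (L A : Matrix (Fin n) (Fin n) ℂ) = R * (A : Matrix (Fin n) (Fin n) ℂ)ᵀ * Rᴴ)) :=
  mainTheorem1_general L
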